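/- Let $R$ be an associative ring with identity (not necessarily commutative), let $M$ be a left $R$-module and let $\mathcal A$ be a family of submodules of $M$. A right $R$-module $T$ is called *$M$-$\mathcal A$-flat* if $T\otimes_R A\to T\otimes_R M$ is injective for every $A\in\mathcal A$, and *strongly $M$-$\mathcal A$-flat* if for every left $R$-module $Y$ and every submodule $X\subseteq Y$ with $Y/X\cong M/A$ for some $A\in\mathcal A$, the map $T\otimes_R X\to T\otimes_R Y$ is injective (equivalently, $\mathrm{Tor}_1^R(T,M/A)=0$ for all $A\in\mathcal A$). The module $M$ is called an *$F\mathcal A$-module* if every $A\in\mathcal A$ is flat, and *$\mathcal A$-coherent* if every $A\in\mathcal A$ is finitely presented. For a class $\mathcal C$ of right $R$-modules, a *$\mathcal C$-preenvelope* of a right $R$-module $B$ is a homomorphism $\theta:B\to C$ with $C\in\mathcal C$ such that every homomorphism from $B$ to a member of $\mathcal C$ factors through $\theta$; it is *epic* if $\theta$ is surjective. Consider the following conditions. (1) $M$ is an $F\mathcal A$-module. (2) Every submodule of an $M$-$\mathcal A$-flat right $R$-module is $M$-$\mathcal A$-flat. (3) Every right $R$-module has an epic $M$-$\mathcal A$-flat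 preenvelope. (3$'$) Every right $R$-module has an epic strongly $M$-$\mathcal A$-flat preenvelope. Then (1) implies (2). If $M$ is flat, then (2) implies (1). If $M$ is $\mathcal A$-coherent and flat, then (1), (2), (3) and (3$'$) are all equivalent. -/

import Mathlib

open scoped TensorProduct

universe u v w

/- Throughout, `R` is an associative ring with identity, not necessarily commutative. Left
`R`-modules are `Module R N`, and right `R`-modules are `Module Rᵐᵒᵖ T`, the right action
`t · r` being `MulOpposite.op r • t`. -/

namespace RelFlat

/-- The subgroup of `T ⊗[ℤ] N` generated by the elements `(t · r) ⊗ n - t ⊗ (r • n)`. -/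
def balancedRel (R : Type*) [Ring R] (T N : Type*) [AddCommGroup T] [Module Rᵐᵒᵖ T]
    [AddCommGroup N] [Module R N] : AddSubgroup (T ⊗[ℤ] N) :=
  AddSubgroup.closure {z | ∃ (t : T) (r : R) (n : N),
    z = (MulOpposite.op r • t) ⊗ₜ[ℤ] n - t ⊗ₜ[ℤ] (r • n)}

/-- The tensor product `T ⊗_R N` of a right `R`-module `T` and a left `R`-module `N`, an
abelian group. -/
abbrev BTensor (R : Type*) [Ring R] (T N : Type*) [AddCommGroup T] [Module Rᵐᵒᵖ T]
    [AddCommGroup N] [Module R N] : Type _ :=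
  (T ⊗[ℤ] N) ⧸ balancedRel R T N

section map

variable {R : Type*} [Ring R]
  {T T' : Type*} [AddCommGroup T] [Module Rᵐᵒᵖ T] [AddCommGroup T'] [Module Rᵐᵒᵖ T']
  {N N' : Type*} [AddCommGroup N] [Module R N] [AddCommGroup N'] [Module R N']

/-- The map `T ⊗[ℤ] N → T' ⊗[ℤ] N'` induced by `R`-linear maps `f` and `g`. -/
def intMap (f : T →ₗ[Rᵐᵒᵖ] T') (g : N →ₗ[R] N') : T ⊗[ℤ] N →+ T' ⊗[ℤ] N' :=
  (TensorProduct.map f.toAddMonoidHom.toIntLinearMap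
    g.toAddMonoidHom.toIntLinearMap).toAddMonoidHom

theorem intMap_tmul (f : T →ₗ[Rᵐᵒᵖ] T') (g : N →ₗ[R] N') (t : T) (n : N) :
    intMap f g (t ⊗ₜ[ℤ] n) = f t ⊗ₜ[ℤ] g n := rfl

theorem balancedRel_le_comap (f : T →ₗ[Rᵐᵒᵖ] T') (g : N →ₗ[R] N') :
    balancedRel R T N ≤ (balancedRel R T' N').comap (intMap f g) := by
  refine (AddSubgroup.closure_le _).2 ?_
  rintro _ ⟨t, r, n, rfl⟩
  refine AddSubgroup.subset_closure ⟨f t, r, g n, ?_⟩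
  simp [intMap_tmul]

/-- The map `f ⊗ g : T ⊗_R N → T' ⊗_R N'` induced by `R`-linear maps `f` and `g`. -/
def BTensor.map (f : T →ₗ[Rᵐᵒᵖ] T') (g : N →ₗ[R] N') : BTensor R T N →+ BTensor R T' N' :=
  QuotientAddGroup.map _ _ (intMap f g) (balancedRel_le_comap f g)

end map

/-- The left `R`-module `N` is flat: `- ⊗_R N` preserves injectivity of homomorphisms of right
`R`-modules. (The right modules live in `Type w`; the notion does not depend on `w` as soon as
this universe contains a copy of `R`.) -/
def IsFlat (R : Type u) [Ring R] (N : Type v) [AddCommGroup N] [Module R N] : Prop :=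
  ∀ (B C : Type w) [AddCommGroup B] [Module Rᵐᵒᵖ B] [AddCommGroup C] [Module Rᵐᵒᵖ C]
    (f : B →ₗ[Rᵐᵒᵖ] C), Function.Injective f →
      Function.Injective (BTensor.map f (LinearMap.id : N →ₗ[R] N))

section family

variable {R : Type u} [Ring R] {M : Type v} [AddCommGroup M] [Module R M]

/-- `M` is an `F𝒜`-module: every member of `𝒜` is flat. -/
def IsFModule (𝒜 : Set (Submodule R M)) : Prop :=
  ∀ A ∈ 𝒜, IsFlat.{u, v, w} R A

/-- `M` is `𝒜`-coherent: every member of `𝒜` is finitely presented. -/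
def IsCoherentFor (𝒜 : Set (Submodule R M)) : Prop :=
  ∀ A ∈ 𝒜, Module.FinitePresentation R A

/-- The right module `T` is `M`-`𝒜`-flat: `T ⊗_R A → T ⊗_R M` is injective for all `A ∈ 𝒜`. -/
def IsRelFlat (𝒜 : Set (Submodule R M))
    (T : Type w) [AddCommGroup T] [Module Rᵐᵒᵖ T] : Prop :=
  ∀ A ∈ 𝒜, Function.Injective (BTensor.map (LinearMap.id : T →ₗ[Rᵐᵒᵖ] T) A.subtype)

/-- The right module `T` is strongly `M`-`𝒜`-flat: for every left module `Y` and every submodule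
`X` of `Y` such that `Y / X ≅ M / A` for some `A ∈ 𝒜`, the map `T ⊗_R X → T ⊗_R Y` is injective.
(`Type (max u v)` contains copies of `M` and of a free cover of each `M / A`, so that this says
`Tor₁(T, M / A) = 0` for all `A ∈ 𝒜`.) -/
def IsStronglyRelFlat (𝒜 : Set (Submodule R M))
    (T : Type w) [AddCommGroup T] [Module Rᵐᵒᵖ T] : Prop :=
  ∀ A ∈ 𝒜, ∀ (Y : Type (max u v)) [AddCommGroup Y] [Module R Y] (X : Submodule R Y),
    Nonempty ((Y ⧸ X) ≃ₗ[R] (M ⧸ A)) →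
      Function.Injective (BTensor.map (LinearMap.id : T →ₗ[Rᵐᵒᵖ] T) X.subtype)

/-- Every submodule of an `M`-`𝒜`-flat right module is `M`-`𝒜`-flat. -/
def RelFlatClosedUnderSubmodules (𝒜 : Set (Submodule R M)) : Prop :=
  ∀ (B : Type w) [AddCommGroup B] [Module Rᵐᵒᵖ B], IsRelFlat 𝒜 B →
    ∀ C : Submodule Rᵐᵒᵖ B, IsRelFlat 𝒜 C

end family

/-- `θ : B → C` is a preenvelope of the right module `B` with respect to the class `𝒞` of right
modules: `C` is in `𝒞` and every homomorphism from `B` to a member of `𝒞` factors through `θ`. -/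
def IsPreenvelope {R : Type u} [Ring R]
    (𝒞 : ∀ (T : Type w) [AddCommGroup T] [Module Rᵐᵒᵖ T], Prop)
    {B C : Type w} [AddCommGroup B] [Module Rᵐᵒᵖ B] [AddCommGroup C] [Module Rᵐᵒᵖ C]
    (θ : B →ₗ[Rᵐᵒᵖ] C) : Prop :=
  𝒞 C ∧ ∀ (D : Type w) [AddCommGroup D] [Module Rᵐᵒᵖ D], 𝒞 D →
    ∀ f : B →ₗ[Rᵐᵒᵖ] D, ∃ g : C →ₗ[Rᵐᵒᵖ] D, g ∘ₗ θ = f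

/-- Every right `R`-module has an epic (that is, surjective) `𝒞`-preenvelope. -/
def HasEpicPreenvelopes (R : Type u) [Ring R]
    (𝒞 : ∀ (T : Type w) [AddCommGroup T] [Module Rᵐᵒᵖ T], Prop) : Prop :=
  ∀ (B : Type w) [AddCommGroup B] [Module Rᵐᵒᵖ B],
    ∃ (C : Type w) (_ : AddCommGroup C) (_ : Module Rᵐᵒᵖ C) (θ : B →ₗ[Rᵐᵒᵖ] C),
      Function.Surjective θ ∧ IsPreenvelope 𝒞 θ

end RelFlat

/-! Conditions (1) and (2) are linked by the commutative square of `C ⊗ A`, `C ⊗ M`, `B ⊗ A`, `B ⊗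
M` for `C ≤ B` and `A ∈ 𝒜`: if both maps of one path to `B ⊗ M` are injective, so is the first map
of the other path. With `A` flat and `B` relatively flat this gives (2); with `M` flat and `B` free
it gives (1), by `isFlat_of_finsupp`.

Coherence makes relatively flat modules closed under products (`eq_zero_of_map_proj_eq_zero`). Given
(2), the preenvelope of `B` is then its image in the product of all its relatively flat quotients.
Conversely, an epic preenvelope of a submodule of a relatively flat module is injective, hence an
isomorphism.

For flat `M` the two classes of right modules coincide, by a pullback over `M / A` and
`IsFlat.map_injective_of_exact`, so (3) and (3') agree. -/

namespace RelFlat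

namespace BTensor

/-! ### Balanced tensor products and right exactness -/

section basic

variable {R : Type*} [Ring R]
  {T T' T'' : Type*} [AddCommGroup T] [Module Rᵐᵒᵖ T] [AddCommGroup T'] [Module Rᵐᵒᵖ T']
  [AddCommGroup T''] [Module Rᵐᵒᵖ T'']
  {N N' N'' : Type*} [AddCommGroup N] [Module R N] [AddCommGroup N'] [Module R N']
  [AddCommGroup N''] [Module R N'']
  {G : Type*} [AddCommGroup G]

variable (R) in
/-- The pure tensor `t ⊗ n`, as a biadditive map. -/
def mk : T →+ N →+ BTensor R T N :=
  AddMonoidHom.mk' (fun t => AddMonoidHom.mk'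
    (fun n => QuotientAddGroup.mk' (balancedRel R T N) (t ⊗ₜ[ℤ] n))
    (fun a b => by rw [TensorProduct.tmul_add, map_add]))
    (fun a b => by
      ext n
      simp only [AddMonoidHom.mk'_apply, AddMonoidHom.add_apply]
      rw [TensorProduct.add_tmul, map_add])

theorem mk_smul (r : R) (t : T) (n : N) :
    mk R (MulOpposite.op r • t) n = mk R t (r • n) := by
  refine (QuotientAddGroup.eq_iff_sub_mem).2 ?_
  exact AddSubgroup.subset_closure ⟨t, r, n, rfl⟩

@[simp]
theorem map_mk (f : T →ₗ[Rᵐᵒᵖ] T') (g : N →ₗ[R] N') (t : T) (n : N) :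
    map f g (mk R t n) = mk R (f t) (g n) := rfl

theorem induction_on {p : BTensor R T N → Prop} (x : BTensor R T N) (h0 : p 0)
    (hmk : ∀ t n, p (mk R t n)) (hadd : ∀ x y, p x → p y → p (x + y)) : p x := by
  obtain ⟨z, rfl⟩ := QuotientAddGroup.mk'_surjective _ x
  induction z using TensorProduct.induction_on with
  | zero => simpa using h0
  | tmul t n => exact hmk t n
  | add a b ha hb => rw [map_add]; exact hadd _ _ ha hb

theorem hom_ext {φ ψ : BTensor R T N →+ G} (h : ∀ t n, φ (mk R t n) = ψ (mk R t n)) :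
    φ = ψ := by
  refine DFunLike.ext _ _ fun x => ?_
  induction x using induction_on with
  | h0 => simp
  | hmk t n => exact h t n
  | hadd x y hx hy => rw [map_add, map_add, hx, hy]

/-- The additive map out of `T ⊗_R N` induced by a balanced biadditive map. -/
def lift (φ : T →+ N →+ G)
    (h : ∀ t (r : R) n, φ (MulOpposite.op r • t) n = φ t (r • n)) : BTensor R T N →+ G :=
  QuotientAddGroup.lift _ (TensorProduct.liftAddHom φ (fun k t n => by simp)) <| by
    refine (AddSubgroup.closure_le _).2 ?_
    rintro _ ⟨t, r, n, rfl⟩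
    change TensorProduct.liftAddHom φ _ _ = 0
    rw [map_sub, TensorProduct.liftAddHom_tmul, TensorProduct.liftAddHom_tmul, h, sub_self]

theorem map_map (f : T →ₗ[Rᵐᵒᵖ] T') (g : N →ₗ[R] N') (f' : T' →ₗ[Rᵐᵒᵖ] T'')
    (g' : N' →ₗ[R] N'') (x : BTensor R T N) :
    map f' g' (map f g x) = map (f' ∘ₗ f) (g' ∘ₗ g) x :=
  DFunLike.congr_fun (hom_ext (φ := (map f' g').comp (map f g))
    (ψ := map (f' ∘ₗ f) (g' ∘ₗ g)) fun _ _ => rfl) x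

theorem map_id_apply (x : BTensor R T N) :
    map (LinearMap.id : T →ₗ[Rᵐᵒᵖ] T) (LinearMap.id : N →ₗ[R] N) x = x :=
  DFunLike.congr_fun (hom_ext (φ := map (LinearMap.id : T →ₗ[Rᵐᵒᵖ] T)
    (LinearMap.id : N →ₗ[R] N)) (ψ := AddMonoidHom.id _) fun _ _ => rfl) x

theorem map_surjective {f : T →ₗ[Rᵐᵒᵖ] T'} {g : N →ₗ[R] N'} (hf : Function.Surjective f)
    (hg : Function.Surjective g) : Function.Surjective (map f g) := by
  intro y
  induction y using induction_on with
  | h0 => exact ⟨0, map_zero _⟩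
  | hmk t n =>
    obtain ⟨t, rfl⟩ := hf t
    obtain ⟨n, rfl⟩ := hg n
    exact ⟨mk R t n, rfl⟩
  | hadd x y hx hy =>
    obtain ⟨x, rfl⟩ := hx
    obtain ⟨y, rfl⟩ := hy
    exact ⟨x + y, map_add _ _ _⟩

theorem map_zero_right (f : T →ₗ[Rᵐᵒᵖ] T') (x : BTensor R T N) :
    map f (0 : N →ₗ[R] N') x = 0 :=
  DFunLike.congr_fun (hom_ext (φ := map f (0 : N →ₗ[R] N')) (ψ := 0)
    fun t n => by simp) x

theorem map_zero_left (g : N →ₗ[R] N') (x : BTensor R T N) :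
    map (0 : T →ₗ[Rᵐᵒᵖ] T') g x = 0 :=
  DFunLike.congr_fun (hom_ext (φ := map (0 : T →ₗ[Rᵐᵒᵖ] T') g) (ψ := 0)
    fun t n => by simp) x

/-- `T ⊗_R -` is right exact. -/
theorem exact_right {f : N →ₗ[R] N'} {g : N' →ₗ[R] N''} (hfg : Function.Exact f g)
    (hg : Function.Surjective g) :
    Function.Exact (map (LinearMap.id : T →ₗ[Rᵐᵒᵖ] T) f)
      (map (LinearMap.id : T →ₗ[Rᵐᵒᵖ] T) g) := by
  set S := (map (LinearMap.id : T →ₗ[Rᵐᵒᵖ] T) f).range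
  have key (t : T) (a b : N') (hab : g a = g b) :
      QuotientAddGroup.mk' S (mk R t a) = QuotientAddGroup.mk' S (mk R t b) := by
    obtain ⟨c, hc⟩ := (hfg (a - b)).1 (by rw [map_sub, hab, sub_self])
    refine (QuotientAddGroup.eq_iff_sub_mem).2 ⟨mk R t c, ?_⟩
    rw [map_mk, hc, map_sub]; rfl
  -- `s` is only a set-theoretic section; `key` makes its pure tensors additive and balanced modulo
  -- `S`, which yields an inverse from `T ⊗ N''` to the cokernel.
  choose s hs using hg
  let φ : T →+ N'' →+ (BTensor R T N' ⧸ S) :=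
    AddMonoidHom.mk' (fun t => AddMonoidHom.mk'
      (fun n => QuotientAddGroup.mk' S (mk R t (s n)))
      (fun a b => by
        rw [← map_add, ← map_add]
        exact key _ _ _ (by simp [hs])))
      (fun a b => by ext n; simp)
  have hφ (t : T) (r : R) (n : N'') : φ (MulOpposite.op r • t) n = φ t (r • n) := by
    change QuotientAddGroup.mk' S (mk R _ (s n)) = QuotientAddGroup.mk' S (mk R t (s (r • n)))
    rw [mk_smul]
    exact key _ _ _ (by simp [hs])
  intro y
  constructor
  · intro hy
    have h : (lift φ hφ).comp (map (LinearMap.id : T →ₗ[Rᵐᵒᵖ] T) g) = QuotientAddGroup.mk' S :=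
      hom_ext fun t n => key t _ _ (hs _)
    have := DFunLike.congr_fun h y
    rw [AddMonoidHom.comp_apply, hy, map_zero] at this
    exact (QuotientAddGroup.eq_zero_iff y).1 this.symm
  · rintro ⟨x, rfl⟩
    rw [map_map, hfg.linearMap_comp_eq_zero, map_zero_right]

/-- `- ⊗_R N` is right exact. -/
theorem exact_left {f : T →ₗ[Rᵐᵒᵖ] T'} {g : T' →ₗ[Rᵐᵒᵖ] T''} (hfg : Function.Exact f g)
    (hg : Function.Surjective g) :
    Function.Exact (map f (LinearMap.id : N →ₗ[R] N)) (map g (LinearMap.id : N →ₗ[R] N)) := by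
  set S := (map f (LinearMap.id : N →ₗ[R] N)).range
  have key (n : N) (a b : T') (hab : g a = g b) :
      QuotientAddGroup.mk' S (mk R a n) = QuotientAddGroup.mk' S (mk R b n) := by
    obtain ⟨c, hc⟩ := (hfg (a - b)).1 (by rw [map_sub, hab, sub_self])
    refine (QuotientAddGroup.eq_iff_sub_mem).2 ⟨mk R c n, ?_⟩
    rw [map_mk, hc, map_sub]; rfl
  choose s hs using hg
  let φ : T'' →+ N →+ (BTensor R T' N ⧸ S) :=
    AddMonoidHom.mk' (fun t => AddMonoidHom.mk'
      (fun n => QuotientAddGroup.mk' S (mk R (s t) n))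
      (fun a b => by rw [← map_add, ← map_add]))
      (fun a b => by
        ext n
        simp only [AddMonoidHom.mk'_apply, AddMonoidHom.add_apply]
        rw [← map_add, ← AddMonoidHom.add_apply, ← map_add]
        exact key _ _ _ (by simp [hs]))
  have hφ (t : T'') (r : R) (n : N) : φ (MulOpposite.op r • t) n = φ t (r • n) := by
    change QuotientAddGroup.mk' S (mk R (s _) n) = QuotientAddGroup.mk' S (mk R (s t) (r • n))
    rw [← mk_smul]
    exact key _ _ _ (by simp [hs])
  intro y
  constructor
  · intro hy
    have h : (lift φ hφ).comp (map g (LinearMap.id : N →ₗ[R] N)) = QuotientAddGroup.mk' S :=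
      hom_ext fun t n => key n _ _ (hs _)
    have := DFunLike.congr_fun h y
    rw [AddMonoidHom.comp_apply, hy, map_zero] at this
    exact (QuotientAddGroup.eq_zero_iff y).1 this.symm
  · rintro ⟨x, rfl⟩
    rw [map_map, hfg.linearMap_comp_eq_zero, map_zero_left]

end basic

/-! ### Tensoring with free right modules -/

section free

variable {R : Type*} [Ring R] {ι : Type*}
  {N N' : Type*} [AddCommGroup N] [Module R N] [AddCommGroup N'] [Module R N']

/-- The canonical map from `(ι →₀ R) ⊗_R N` to `ι →₀ N`. -/
noncomputable def finsuppCoord : BTensor R (ι →₀ Rᵐᵒᵖ) N →+ (ι →₀ N) :=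
  lift (AddMonoidHom.mk' (fun f => AddMonoidHom.mk'
    (fun n => f.mapRange (fun r => r.unop • n) (by simp))
    (fun a b => by ext i; simp))
    (fun a b => by ext n i; simp [add_smul]))
    (fun f r n => by ext i; simp [mul_smul])

theorem finsuppCoord_mk (f : ι →₀ Rᵐᵒᵖ) (n : N) (i : ι) :
    finsuppCoord (mk R f n) i = (f i).unop • n := rfl

theorem finsuppCoord_map (g : N →ₗ[R] N') (x : BTensor R (ι →₀ Rᵐᵒᵖ) N) (i : ι) :
    finsuppCoord (map LinearMap.id g x) i = g (finsuppCoord x i) := by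
  induction x using induction_on with
  | h0 => simp
  | hmk t n => simp [finsuppCoord_mk]
  | hadd x y hx hy => simp [hx, hy]

theorem finsuppCoord_injective :
    Function.Injective (finsuppCoord (R := R) (ι := ι) (N := N)) := by
  let ψ : (ι →₀ N) →+ BTensor R (ι →₀ Rᵐᵒᵖ) N :=
    Finsupp.liftAddHom fun i => mk R (Finsupp.single i (1 : Rᵐᵒᵖ))
  have h : ψ.comp finsuppCoord = AddMonoidHom.id (BTensor R (ι →₀ Rᵐᵒᵖ) N) := by
    refine hom_ext fun f n => ?_
    induction f using Finsupp.induction_linear with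
    | zero => simp
    | add f g hf hg =>
      rw [map_add, AddMonoidHom.add_apply, map_add, map_add, hf, hg]
    | single i r =>
      have h1 : finsuppCoord (mk R (Finsupp.single i r) n) = Finsupp.single i (r.unop • n) := by
        classical
        ext j
        rw [finsuppCoord_mk, Finsupp.single_apply, Finsupp.single_apply]
        split_ifs <;> simp
      rw [AddMonoidHom.comp_apply, h1]
      simp only [ψ, Finsupp.liftAddHom_apply_single, AddMonoidHom.id_apply]
      rw [← mk_smul]
      simp
  exact Function.LeftInverse.injective (g := ψ) fun x => DFunLike.congr_fun h x

/-- Free right modules are flat. -/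
theorem map_finsupp_injective {g : N →ₗ[R] N'} (hg : Function.Injective g) :
    Function.Injective (map (LinearMap.id : (ι →₀ Rᵐᵒᵖ) →ₗ[Rᵐᵒᵖ] (ι →₀ Rᵐᵒᵖ)) g) := by
  intro x y hxy
  refine finsuppCoord_injective (Finsupp.ext fun i => hg ?_)
  rw [← finsuppCoord_map, ← finsuppCoord_map, hxy]

end free

/-! ### Products and finitely presented modules -/

section pi

variable {R : Type*} [Ring R]

section coord

variable {T : Type*} [AddCommGroup T] [Module Rᵐᵒᵖ T] {κ : Type*}

/-- The coordinates of an element of `T ⊗_R R ^ κ`. -/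
def piCoord (j : κ) : BTensor R T (κ → R) →+ T :=
  lift (AddMonoidHom.mk' (fun t => AddMonoidHom.mk'
    (fun v => MulOpposite.op (v j) • t) (fun a b => by simp [add_smul]))
    (fun a b => by ext n; simp))
    (fun t r n => by simp [mul_smul])

theorem piCoord_mk (j : κ) (t : T) (v : κ → R) :
    piCoord j (mk R t v) = MulOpposite.op (v j) • t := rfl

variable [Fintype κ] [DecidableEq κ]

theorem sum_piCoord (x : BTensor R T (κ → R)) :
    ∑ j, mk R (piCoord j x) (Pi.single j 1) = x := by
  induction x using induction_on with
  | h0 => simp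
  | hmk t v =>
    simp only [piCoord_mk, mk_smul]
    rw [← map_sum]
    congr 1
    ext k
    simp [Finset.sum_apply, Pi.single_apply]
  | hadd x y hx hy =>
    simp only [map_add, AddMonoidHom.add_apply, Finset.sum_add_distrib, hx, hy]

end coord

variable {ι : Type*} {T : ι → Type*} [∀ i, AddCommGroup (T i)] [∀ i, Module Rᵐᵒᵖ (T i)]
  {N : Type*} [AddCommGroup N] [Module R N]

theorem piCoord_map_proj {κ : Type*} (i : ι) (j : κ) (x : BTensor R (∀ i, T i) (κ → R)) :
    piCoord j (map (LinearMap.proj i) LinearMap.id x) = piCoord j x i := by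
  induction x using induction_on with
  | h0 => simp
  | hmk t n => rfl
  | hadd x y hx hy => rw [map_add, map_add, map_add, hx, hy]; rfl

/-- For a finitely presented module `N`, the canonical map `(∏ T i) ⊗_R N → ∏ (T i ⊗_R N)` is
injective. -/
theorem eq_zero_of_map_proj_eq_zero [Module.FinitePresentation R N]
    (x : BTensor R (∀ i, T i) N)
    (hx : ∀ i, map (LinearMap.proj i : (∀ i, T i) →ₗ[Rᵐᵒᵖ] T i)
      (LinearMap.id : N →ₗ[R] N) x = 0) : x = 0 := by
  classical
  obtain ⟨n, p, hp⟩ := Module.Finite.exists_fin' R N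
  have hfg : (LinearMap.ker p).FG := Module.FinitePresentation.fg_ker p hp
  have : Module.Finite R (LinearMap.ker p) := Module.Finite.iff_fg.2 hfg
  obtain ⟨m, q', hq'⟩ := Module.Finite.exists_fin' R (LinearMap.ker p)
  let q : (Fin m → R) →ₗ[R] (Fin n → R) := (LinearMap.ker p).subtype ∘ₗ q'
  have hqp : Function.Exact q p := by
    intro y
    constructor
    · intro hy
      obtain ⟨z, hz⟩ := hq' ⟨y, hy⟩
      exact ⟨z, congrArg Subtype.val hz⟩
    · rintro ⟨z, rfl⟩
      exact (q' z).2
  obtain ⟨y, rfl⟩ := map_surjective (f := LinearMap.id) Function.surjective_id hp x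
  have hy (i : ι) : ∃ z : BTensor R (T i) (Fin m → R), map LinearMap.id q z =
      map (LinearMap.proj i : (∀ i, T i) →ₗ[Rᵐᵒᵖ] T i) LinearMap.id y := by
    refine (exact_right hqp hp _).1 ?_
    have := hx i
    rw [map_map] at this ⊢
    exact this
  choose z hz using hy
  -- Since `T ⊗ R ^ m` is `T ^ m`, the unrelated lifts `z i` can be assembled coordinatewise into
  -- one element over the product.
  let w : BTensor R (∀ i, T i) (Fin m → R) :=
    ∑ j, mk R (fun i => piCoord j (z i)) (Pi.single j 1)
  have hw (i : ι) : map (LinearMap.proj i : (∀ i, T i) →ₗ[Rᵐᵒᵖ] T i) LinearMap.id w = z i := by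
    rw [← sum_piCoord (z i), map_sum]
    rfl
  have hwy : map LinearMap.id q w = y := by
    rw [← sum_piCoord (map LinearMap.id q w), ← sum_piCoord y]
    refine Finset.sum_congr rfl fun j _ => ?_
    congr 2
    ext i
    rw [← piCoord_map_proj, ← piCoord_map_proj, ← hz, ← hw, map_map, map_map]
    rfl
  rw [← hwy]
  exact (exact_right hqp hp _).2 ⟨w, rfl⟩

end pi

end BTensor

open BTensor

/-! ### Relative flatness and preenvelopes -/

section

variable {R : Type u} [Ring R] {M : Type v} [AddCommGroup M] [Module R M]
  {𝒜 : Set (Submodule R M)}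

theorem IsFModule.relFlatClosedUnderSubmodules (h : IsFModule.{u, v, w} 𝒜) :
    RelFlatClosedUnderSubmodules.{u, v, w} 𝒜 := by
  intro B _ _ hB C A hA
  have h1 := (hB A hA).comp (h A hA C B C.subtype C.injective_subtype)
  refine Function.Injective.of_comp (f := map C.subtype LinearMap.id) ?_
  convert h1 using 1
  ext x
  simp only [Function.comp_apply, map_map]
  rfl

/-- A right module is the quotient of a free one. -/
theorem exists_finsupp_surjective (C : Type*) [AddCommGroup C] [Module Rᵐᵒᵖ C] :
    ∃ p : (C →₀ Rᵐᵒᵖ) →ₗ[Rᵐᵒᵖ] C, Function.Surjective p :=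
  ⟨Finsupp.linearCombination Rᵐᵒᵖ id, Finsupp.linearCombination_id_surjective _ _⟩

/-- To check flatness it suffices to consider submodules of free modules. -/
theorem isFlat_of_finsupp {N : Type v} [AddCommGroup N] [Module R N]
    (h : ∀ (ι : Type (max u w)) (P : Submodule Rᵐᵒᵖ (ι →₀ Rᵐᵒᵖ)),
      Function.Injective
        (map (T := P) (T' := ι →₀ Rᵐᵒᵖ) P.subtype (LinearMap.id : N →ₗ[R] N))) :
    IsFlat.{u, v, max u w} R N := by
  intro B C _ _ _ _ f hf
  obtain ⟨p, hp⟩ := exists_finsupp_surjective (R := R) C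
  let P : Submodule Rᵐᵒᵖ (C →₀ Rᵐᵒᵖ) := (LinearMap.range f).comap p
  let e : B ≃ₗ[Rᵐᵒᵖ] LinearMap.range f := LinearEquiv.ofInjective f hf
  let p' : P →ₗ[Rᵐᵒᵖ] B := e.symm.toLinearMap ∘ₗ p.restrict (fun _ hx => hx)
  have hp' (x : P) : f (p' x) = p x := by
    have : e (p' x) = p.restrict (q := LinearMap.range f) (fun _ hx => hx) x := by simp [p']
    exact congrArg Subtype.val this
  have hsurj : Function.Surjective p' := by
    intro b
    obtain ⟨x, hx⟩ := hp (f b)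
    exact ⟨⟨x, b, hx.symm⟩, hf (by rw [hp', hx])⟩
  -- `P` is the preimage of `B` in the free cover of `C`, so it contains `ker p`. An element killed
  -- in `C ⊗ N` therefore lifts to `P ⊗ N` as one coming from `ker p ⊗ N`, which dies in `B ⊗ N`.
  let k : LinearMap.ker p →ₗ[Rᵐᵒᵖ] P :=
    Submodule.inclusion (fun x hx => by
      rw [Submodule.mem_comap, LinearMap.mem_ker.1 hx]
      exact zero_mem _)
  refine (injective_iff_map_eq_zero _).2 fun x hx => ?_
  obtain ⟨y, rfl⟩ := map_surjective (T := P) (T' := B) (g := LinearMap.id) hsurj Function.surjective_id x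
  have hfp : f ∘ₗ p' = p ∘ₗ P.subtype := LinearMap.ext hp'
  rw [map_map, hfp, ← map_map _ LinearMap.id _ LinearMap.id] at hx
  obtain ⟨z, hz⟩ := (exact_left (T := LinearMap.ker p) (T' := C →₀ Rᵐᵒᵖ)
    (f := (LinearMap.ker p).subtype)
    (LinearMap.exact_subtype_ker_map p) hp _).1 hx
  have hzy : map k LinearMap.id z = y := by
    refine h C P ?_
    rw [← hz, map_map]
    rfl
  have hpk : p' ∘ₗ k = 0 := by
    ext a
    refine hf ?_
    rw [LinearMap.comp_apply, hp']
    simp [k]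
  rw [← hzy, map_map, hpk, map_zero_left]

theorem RelFlatClosedUnderSubmodules.isFModule (hM : IsFlat.{u, v, max u w} R M)
    (h : RelFlatClosedUnderSubmodules.{u, v, max u w} 𝒜) :
    IsFModule.{u, v, max u w} 𝒜 := by
  intro A hA
  refine isFlat_of_finsupp.{u, v, w} fun ι P => ?_
  have h1 := (hM P (ι →₀ Rᵐᵒᵖ) P.subtype P.injective_subtype).comp
    (h (ι →₀ Rᵐᵒᵖ) (fun A _ => map_finsupp_injective A.injective_subtype) P A hA)
  refine Function.Injective.of_comp (f := map LinearMap.id A.subtype) ?_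
  convert h1 using 1
  ext x
  simp only [Function.comp_apply, map_map]
  rfl

theorem IsRelFlat.of_leftInverse {T T' : Type*} [AddCommGroup T] [Module Rᵐᵒᵖ T]
    [AddCommGroup T'] [Module Rᵐᵒᵖ T'] (h : IsRelFlat 𝒜 T') (i : T →ₗ[Rᵐᵒᵖ] T')
    (r : T' →ₗ[Rᵐᵒᵖ] T) (hri : r ∘ₗ i = LinearMap.id) : IsRelFlat 𝒜 T := by
  intro A hA x y hxy
  have h1 : map i (LinearMap.id : A →ₗ[R] A) x = map i LinearMap.id y := by
    refine h A hA ?_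
    have := congrArg (map i (LinearMap.id : M →ₗ[R] M)) hxy
    rw [map_map, map_map] at this ⊢
    exact this
  have h2 := congrArg (map r (LinearMap.id : A →ₗ[R] A)) h1
  rw [map_map, map_map, hri] at h2
  simpa only [LinearMap.id_comp, map_id_apply] using h2

theorem RelFlatClosedUnderSubmodules.of_injective
    (h : RelFlatClosedUnderSubmodules.{u, v, w} 𝒜) {B C : Type w} [AddCommGroup B]
    [Module Rᵐᵒᵖ B] [AddCommGroup C] [Module Rᵐᵒᵖ C] (hB : IsRelFlat 𝒜 B)
    (f : C →ₗ[Rᵐᵒᵖ] B) (hf : Function.Injective f) : IsRelFlat 𝒜 C := by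
  let e := LinearEquiv.ofInjective f hf
  exact (h B hB (LinearMap.range f)).of_leftInverse e.toLinearMap e.symm.toLinearMap (by simp)

theorem IsCoherentFor.isRelFlat_pi (h : IsCoherentFor 𝒜) {ι : Type*} {T : ι → Type*}
    [∀ i, AddCommGroup (T i)] [∀ i, Module Rᵐᵒᵖ (T i)] (hT : ∀ i, IsRelFlat 𝒜 (T i)) :
    IsRelFlat 𝒜 (∀ i, T i) := by
  intro A hA
  have := h A hA
  refine (injective_iff_map_eq_zero _).2 fun x hx => ?_
  refine eq_zero_of_map_proj_eq_zero x fun i => (injective_iff_map_eq_zero _).1 (hT i A hA) _ ?_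
  have h1 := congrArg (map (LinearMap.proj i : (∀ i, T i) →ₗ[Rᵐᵒᵖ] T i)
    (LinearMap.id : M →ₗ[R] M)) hx
  rw [map_map, map_zero] at h1
  rw [map_map]
  exact h1

theorem RelFlatClosedUnderSubmodules.hasEpicPreenvelopes (hc : IsCoherentFor 𝒜)
    (h : RelFlatClosedUnderSubmodules.{u, v, w} 𝒜) :
    HasEpicPreenvelopes.{u, w} R (fun T _ _ => IsRelFlat.{u, v, w} 𝒜 T) := by
  intro B _ _
  -- Indexing by kernels keeps the product small. By (2), every map to a relatively flat module has
  -- its kernel in this set.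
  let ι := {K : Submodule Rᵐᵒᵖ B // IsRelFlat 𝒜 (B ⧸ K)}
  let f : B →ₗ[Rᵐᵒᵖ] (∀ K : ι, B ⧸ K.1) := LinearMap.pi fun K => K.1.mkQ
  refine ⟨B ⧸ LinearMap.ker f, inferInstance, inferInstance, (LinearMap.ker f).mkQ,
    Submodule.mkQ_surjective _, ?_, ?_⟩
  · exact h.of_injective (hc.isRelFlat_pi fun K : ι => K.2) ((LinearMap.ker f).liftQ f le_rfl)
      (LinearMap.ker_eq_bot.1 (Submodule.ker_liftQ_eq_bot _ _ _ le_rfl))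
  · intro D _ _ hD g
    have hg : IsRelFlat 𝒜 (B ⧸ LinearMap.ker g) :=
      h.of_injective hD ((LinearMap.ker g).liftQ g le_rfl)
        (LinearMap.ker_eq_bot.1 (Submodule.ker_liftQ_eq_bot _ _ _ le_rfl))
    refine ⟨(LinearMap.ker f).liftQ g fun x hx => ?_, Submodule.liftQ_mkQ _ _ _⟩
    have h1 := congrFun (LinearMap.mem_ker.1 hx) ⟨LinearMap.ker g, hg⟩
    exact (Submodule.Quotient.mk_eq_zero _).1 h1

theorem relFlatClosedUnderSubmodules_of_hasEpicPreenvelopes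
    (h : HasEpicPreenvelopes.{u, w} R (fun T _ _ => IsRelFlat.{u, v, w} 𝒜 T)) :
    RelFlatClosedUnderSubmodules.{u, v, w} 𝒜 := by
  intro B _ _ hB C
  obtain ⟨D, _, _, θ, hθ, hD, hfac⟩ := h C
  obtain ⟨g, hg⟩ := hfac B hB C.subtype
  have hinj : Function.Injective θ := by
    refine Function.Injective.of_comp (f := g) ?_
    rw [← LinearMap.coe_comp, hg]
    exact C.injective_subtype
  let e := LinearEquiv.ofBijective θ ⟨hinj, hθ⟩
  exact IsRelFlat.of_leftInverse hD e.toLinearMap e.symm.toLinearMap (by simp)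

theorem IsStronglyRelFlat.isRelFlat {T : Type w} [AddCommGroup T] [Module Rᵐᵒᵖ T]
    (h : IsStronglyRelFlat.{u, v, w} 𝒜 T) : IsRelFlat 𝒜 T := by
  intro A hA
  -- The test module is `Y = M`, lifted to the universe over which `Y` ranges.
  let e : ULift.{u} M ≃ₗ[R] M := ULift.moduleEquiv
  let X : Submodule R (ULift.{u} M) := A.comap e.toLinearMap
  have hX := h A hA (ULift.{u} M) X ⟨Submodule.Quotient.equiv X A e
    (Submodule.map_comap_eq_of_surjective e.surjective A)⟩
  let i : A →ₗ[R] X := e.symm.toLinearMap.restrict fun x hx => by simpa [X] using hx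
  let r : X →ₗ[R] A := e.toLinearMap.restrict fun x hx => hx
  have hri : r ∘ₗ i = LinearMap.id := rfl
  intro x y hxy
  have h1 : map (LinearMap.id : T →ₗ[Rᵐᵒᵖ] T) i x = map LinearMap.id i y := by
    refine hX ?_
    have := congrArg (map (LinearMap.id : T →ₗ[Rᵐᵒᵖ] T) e.symm.toLinearMap) hxy
    rw [map_map, map_map] at this ⊢
    exact this
  have h2 := congrArg (map (LinearMap.id : T →ₗ[Rᵐᵒᵖ] T) r) h1
  rw [map_map, map_map, hri] at h2
  simpa only [LinearMap.id_comp, map_id_apply] using h2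

/-- Tensoring preserves the injectivity of a homomorphism with flat cokernel. -/
theorem IsFlat.map_injective_of_exact (hM : IsFlat.{u, v, max u w} R M)
    {T : Type (max u w)} [AddCommGroup T] [Module Rᵐᵒᵖ T] {X P : Type*} [AddCommGroup X]
    [Module R X] [AddCommGroup P] [Module R P] {f : X →ₗ[R] P} {g : P →ₗ[R] M}
    (hf : Function.Injective f) (hfg : Function.Exact f g) (hg : Function.Surjective g) :
    Function.Injective (map (LinearMap.id : T →ₗ[Rᵐᵒᵖ] T) f) := by
  obtain ⟨p, hp⟩ := exists_finsupp_surjective (R := R) T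
  let K := LinearMap.ker p
  have hKp : Function.Exact K.subtype p := LinearMap.exact_subtype_ker_map p
  refine (injective_iff_map_eq_zero _).2 fun x hx => ?_
  obtain ⟨y, rfl⟩ := map_surjective (g := LinearMap.id) hp Function.surjective_id x
  have hx' : map p LinearMap.id (map LinearMap.id f y) = 0 := by
    rw [map_map] at hx ⊢
    exact hx
  obtain ⟨z, hz⟩ := (exact_left (T := K) (T' := T →₀ Rᵐᵒᵖ) hKp hp _).1 hx'
  -- Here flatness of `M` enters: `K ⊗ M` embeds in the free cover tensored with `M`, where `z` dies
  -- because `g ∘ f = 0`.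
  have hz0 : map (T := K) (T' := K) LinearMap.id g z = 0 := by
    refine (injective_iff_map_eq_zero _).1
      (hM K (T →₀ Rᵐᵒᵖ) K.subtype K.injective_subtype) _ ?_
    have h1 := congrArg (map LinearMap.id g) hz
    rw [map_map, map_map, hfg.linearMap_comp_eq_zero, map_zero_right] at h1
    rw [map_map]
    exact h1
  obtain ⟨k, rfl⟩ := (exact_right hfg hg _).1 hz0
  have hky : map K.subtype LinearMap.id k = y := by
    refine map_finsupp_injective hf ?_
    rw [← hz, map_map, map_map]
    rfl
  rw [← hky]
  exact (exact_left (T := K) (T' := T →₀ Rᵐᵒᵖ) hKp hp _).2 ⟨k, rfl⟩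

/-- The pullback `P` is an extension of `M` by `X` and of `Y` by `A`. Flatness of `M` embeds `T ⊗ X`
in `T ⊗ P`; an element killed in `T ⊗ Y` then comes from `T ⊗ A`, and it vanishes there because its
image in `T ⊗ M` is zero. -/
theorem IsRelFlat.isStronglyRelFlat (hM : IsFlat.{u, v, max u w} R M)
    {T : Type (max u w)} [AddCommGroup T] [Module Rᵐᵒᵖ T] (h : IsRelFlat 𝒜 T) :
    IsStronglyRelFlat.{u, v, max u w} 𝒜 T := by
  rintro A hA Y _ _ X ⟨e⟩
  let a : Y →ₗ[R] (M ⧸ A) := e.toLinearMap ∘ₗ X.mkQ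
  have ha : Function.Surjective a := e.surjective.comp X.mkQ_surjective
  have haX (y : Y) : a y = 0 ↔ y ∈ X := by simp [a]
  -- `P` is the pullback of `Y` and `M` over `M / A`
  let P : Submodule R (Y × M) :=
    LinearMap.eqLocus (a ∘ₗ LinearMap.fst R Y M) (A.mkQ ∘ₗ LinearMap.snd R Y M)
  have hP (z : Y × M) : z ∈ P ↔ a z.1 = A.mkQ z.2 := Iff.rfl
  let pY : P →ₗ[R] Y := LinearMap.fst R Y M ∘ₗ P.subtype
  let pM : P →ₗ[R] M := LinearMap.snd R Y M ∘ₗ P.subtype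
  have hpY : Function.Surjective pY := fun y => by
    obtain ⟨m, hm⟩ := A.mkQ_surjective (a y)
    exact ⟨⟨(y, m), hm.symm⟩, rfl⟩
  have hpM : Function.Surjective pM := fun m => by
    obtain ⟨y, hy⟩ := ha (A.mkQ m)
    exact ⟨⟨(y, m), hy⟩, rfl⟩
  let iX : X →ₗ[R] P := (LinearMap.inl R Y M ∘ₗ X.subtype).codRestrict P fun x =>
    (hP _).2 (by simpa using (haX x).2 x.2)
  let iA : A →ₗ[R] P := (LinearMap.inr R Y M ∘ₗ A.subtype).codRestrict P fun x =>
    (hP _).2 (by simpa using ((Submodule.Quotient.mk_eq_zero A).2 x.2).symm)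
  have hiX : Function.Injective iX := fun x y hxy =>
    Subtype.ext (congrArg (fun z : P => z.1.1) hxy)
  have hXM : Function.Exact iX pM := by
    rintro ⟨⟨y, m⟩, hz⟩
    constructor
    · rintro (rfl : m = 0)
      rw [hP] at hz
      exact ⟨⟨y, (haX y).1 (by simpa using hz)⟩, rfl⟩
    · rintro ⟨x, hx⟩
      rw [← hx]; rfl
  have hAY : Function.Exact iA pY := by
    rintro ⟨⟨y, m⟩, hz⟩
    constructor
    · rintro (rfl : y = 0)
      rw [hP] at hz
      exact ⟨⟨m, by simpa using hz.symm⟩, rfl⟩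
    · rintro ⟨x, hx⟩
      rw [← hx]; rfl
  refine (injective_iff_map_eq_zero _).2 fun x hx => ?_
  refine (injective_iff_map_eq_zero _).1 (hM.map_injective_of_exact.{u, v, w} hiX hXM hpM) _ ?_
  have h1 : map (LinearMap.id : T →ₗ[Rᵐᵒᵖ] T) pY (map LinearMap.id iX x) = 0 := by
    rw [map_map]
    exact hx
  obtain ⟨c, hc⟩ := (exact_right hAY hpY _).1 h1
  have hc0 : c = 0 := by
    refine (injective_iff_map_eq_zero _).1 (h A hA) _ ?_
    have h2 := congrArg (map (LinearMap.id : T →ₗ[Rᵐᵒᵖ] T) pM) hc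
    rw [(exact_right hXM hpM).apply_apply_eq_zero, map_map] at h2
    exact h2
  rw [← hc, hc0, map_zero]

theorem hasEpicPreenvelopes_congr
    {𝒞 𝒟 : ∀ (T : Type w) [AddCommGroup T] [Module Rᵐᵒᵖ T], Prop}
    (h : ∀ (T : Type w) [AddCommGroup T] [Module Rᵐᵒᵖ T], 𝒞 T ↔ 𝒟 T) :
    HasEpicPreenvelopes R 𝒞 ↔ HasEpicPreenvelopes R 𝒟 := by
  simp only [HasEpicPreenvelopes, IsPreenvelope, h]

end

end RelFlat

theorem proposition3p2 {R : Type u} [Ring R] {M : Type v} [AddCommGroup M] [Module R M]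
    (𝒜 : Set (Submodule R M)) :
    (RelFlat.IsFModule.{u, v, max u w} 𝒜 →
      RelFlat.RelFlatClosedUnderSubmodules.{u, v, max u w} 𝒜) ∧
    (RelFlat.IsFlat.{u, v, max u w} R M →
      RelFlat.RelFlatClosedUnderSubmodules.{u, v, max u w} 𝒜 →
        RelFlat.IsFModule.{u, v, max u w} 𝒜) ∧
    (RelFlat.IsCoherentFor 𝒜 → RelFlat.IsFlat.{u, v, max u w} R M →
      List.TFAE
        [RelFlat.IsFModule.{u, v, max u w} 𝒜,
         RelFlat.RelFlatClosedUnderSubmodules.{u, v, max u w} 𝒜,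
         RelFlat.HasEpicPreenvelopes.{u, max u w} R
          (fun T _ _ => RelFlat.IsRelFlat.{u, v, max u w} 𝒜 T),
         RelFlat.HasEpicPreenvelopes.{u, max u w} R
          (fun T _ _ => RelFlat.IsStronglyRelFlat.{u, v, max u w} 𝒜 T)]) := by
  refine ⟨fun h => h.relFlatClosedUnderSubmodules, fun hM h =>
    RelFlat.RelFlatClosedUnderSubmodules.isFModule.{u, v, w} hM h, fun hc hM => ?_⟩
  tfae_have 1 → 2 := fun h => h.relFlatClosedUnderSubmodules
  tfae_have 2 → 1 := fun h => RelFlat.RelFlatClosedUnderSubmodules.isFModule.{u, v, w} hM h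
  tfae_have 2 → 3 := fun h => h.hasEpicPreenvelopes hc
  tfae_have 3 → 2 := fun h => RelFlat.relFlatClosedUnderSubmodules_of_hasEpicPreenvelopes h
  tfae_have 3 ↔ 4 := RelFlat.hasEpicPreenvelopes_congr fun T _ _ =>
    ⟨fun h => RelFlat.IsRelFlat.isStronglyRelFlat.{u, v, w} hM h, fun h => h.isRelFlat⟩
  tfae_finish
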